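/- Let $M$ be a finite-dimensional smooth (Hausdorff) manifold, let $a:TM\to TM$ be a smooth bundle map with dual $a^*:T^*M\to T^*M$, let $\pi$ be a smooth bivector field and $\sigma$ a smooth 2-form on $M$, with $\beta(\pi^\sharp\alpha)=\pi(\alpha,\beta)$ and $\sigma_\sharp(X)(Y)=\sigma(X,Y)$. Let $$\mathcal J=\begin{pmatrix} a & \pi^\sharp\\ \sigma_\sharp & -a^*\end{pmatrix}:TM\oplus T^*M\to TM\oplus T^*M .$$ The Courant bracket is $[(X,\xi),(Y,\eta)]=\bigl([X,Y],\ L_X\eta-L_Y\xi-\tfrac12 d(i_X\eta-i_Y\xi)\bigr)$. Put $[\xi,\eta]_\pi=L_{\pi^\sharp\xi}\eta-L_{\pi^\sharp\eta}\xi-d(\pi(\xi,\eta))$, $N_a(X,Y)=[aX,aY]+a^2[X,Y]-a([aX,Y]+[X,aY])$, $i_{X\wedge Y}d\sigma=d\sigma(X,Y,\cdot)$ and $\sigma_a(X,Y)=\sigma(aX,Y)$. Then $\mathcal J$ is a generalized subtangent structure, that is, $\mathcal J^2=0$ and $$[\mathcal Ju,\mathcal Jv]-\mathcal J\bigl([\mathcal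 Ju,v]+[u,\mathcal Jv]\bigr)=0\quad\text{for all smooth sections }u,v\text{ of }TM\oplus T^*M,$$ if and only if the following hold for all smooth 1-forms $\xi,\eta$ and all smooth vector fields $X,Y,Z$: (S1) $\pi^\sharp([\xi,\eta]_\pi)=[\pi^\sharp\xi,\pi^\sharp\eta]$; (S2) $a\pi^\sharp=\pi^\sharp a^*$ and $a^*([\xi,\eta]_\pi)=L_{\pi^\sharp\xi}(a^*\eta)-L_{\pi^\sharp\eta}(a^*\xi)-d(\pi(a^*\xi,\eta))$; (S3) $a^2+\pi^\sharp\sigma_\sharp=0$ and $N_a(X,Y)=\pi^\sharp(i_{X\wedge Y}d\sigma)$; (S4) $a^*\sigma_\sharp=\sigma_\sharp a$ (so that $\sigma_a$ is a 2-form) and $d\sigma_a(X,Y,Z)=d\sigma(aX,Y,Z)+d\sigma(X,aY,Z)+d\sigma(X,Y,aZ)$. -/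

import Mathlib

open scoped Manifold ContDiff Topology

noncomputable section

namespace GenGeom

section Fields

variable (E : Type*) [NormedAddCommGroup E] [NormedSpace ℝ E]
  {M : Type*} [TopologicalSpace M] [ChartedSpace E M]

/-- The tangent space `T_x M`. -/
abbrev Tan (x : M) : Type _ := TangentSpace 𝓘(ℝ, E) x

/-- The cotangent space `T_x^* M`. -/
abbrev Cot (x : M) : Type _ := Tan E x →L[ℝ] ℝ

/-- The fibre at `x` of the generalized tangent bundle `TM ⊕ T^*M`. -/
abbrev GTan (x : M) : Type _ := Tan E x × Cot E x

end Fields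

section Smooth

variable (E : Type*) [NormedAddCommGroup E] [NormedSpace ℝ E]
  (M : Type*) [TopologicalSpace M] [ChartedSpace E M] [IsManifold 𝓘(ℝ, E) ∞ M]

/-- Smooth vector fields: smooth sections of `TM`. -/
abbrev VectorField : Type _ :=
  ContMDiffSection 𝓘(ℝ, E) E ∞ (fun x : M ↦ Tan E x)

/-- Smooth 1-forms: smooth sections of `T^*M`. -/
abbrev OneForm : Type _ :=
  ContMDiffSection 𝓘(ℝ, E) (E →L[ℝ] ℝ) ∞ (fun x : M ↦ Tan E x →L[ℝ] ℝ)

/-- Smooth bundle maps `TM → TM`, that is, smooth (1,1)-tensors. -/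
abbrev EndoField : Type _ :=
  ContMDiffSection 𝓘(ℝ, E) (E →L[ℝ] E) ∞ (fun x : M ↦ Tan E x →L[ℝ] Tan E x)

/-- Smooth 2-forms: smooth sections `σ` of the bundle of bilinear forms on `TM` that are alternating
at every point. In curried form `σ` is at the same time the bundle map `σ_♯ : TM → T^*M`,
`σ_♯(X)(Y) = σ(X, Y)`. -/
structure TwoForm where
  /-- the bundle map `σ_♯`, i.e. the curried bilinear form -/
  flat : ContMDiffSection 𝓘(ℝ, E) (E →L[ℝ] E →L[ℝ] ℝ) ∞
    (fun x : M ↦ Tan E x →L[ℝ] Tan E x →L[ℝ] ℝ)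
  alternating : ∀ (x : M) (v : Tan E x), flat x v v = 0

/-- Smooth bivector fields on a finite-dimensional manifold. Since `T_x M` is reflexive, a bilinear
form `π` on `T_x^*M` is the same as the linear map `π^♯ : T_x^*M → T_x M` with
`β(π^♯ α) = π(α, β)`; a bivector field is a smooth `π` which is alternating at every point. -/
structure Bivector where
  /-- the bundle map `π^♯` -/
  sharp : ContMDiffSection 𝓘(ℝ, E) ((E →L[ℝ] ℝ) →L[ℝ] E) ∞
    (fun x : M ↦ (Tan E x →L[ℝ] ℝ) →L[ℝ] Tan E x)
  alternating : ∀ (x : M) (α : Cot E x), α (sharp x α) = 0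

end Smooth

variable {E : Type*} [NormedAddCommGroup E] [NormedSpace ℝ E]
  {M : Type*} [TopologicalSpace M] [ChartedSpace E M]

/-- `π(α, β) = β(π^♯ α)`. -/
def Bivector.pair [IsManifold 𝓘(ℝ, E) ∞ M] (π : Bivector E M) (x : M) (α β : Cot E x) : ℝ :=
  β (π.sharp x α)

/-! ### Calculus with differential forms -/

/-- The alternating 2-form `(v, w) ↦ B v w` on `T_x M` given by a curried bilinear form `B`. -/
def altOfBilin {x : M} (B : Tan E x →L[ℝ] Tan E x →L[ℝ] ℝ) (h : ∀ v, B v v = 0) :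
    Tan E x [⋀^Fin 2]→L[ℝ] ℝ where
  toFun v := B (v 0) (v 1)
  map_update_add' v i a b := by
    fin_cases i <;> simp [Function.update]
  map_update_smul' v i c a := by
    fin_cases i <;> simp [Function.update]
  cont := by
    have key : ∀ B' : E →L[ℝ] E →L[ℝ] ℝ, Continuous fun v : Fin 2 → E ↦ B' (v 0) (v 1) := by
      intro B'
      fun_prop
    exact key B
  map_eq_zero_of_eq' v i j hv hij := by
    fin_cases i <;> fin_cases j <;> simp_all

@[simp] theorem altOfBilin_apply {x : M} (B : Tan E x →L[ℝ] Tan E x →L[ℝ] ℝ)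
    (h : ∀ v, B v v = 0) (v : Fin 2 → Tan E x) : altOfBilin B h v = B (v 0) (v 1) := rfl

/-- The expression of a `k`-form `θ` in the chart at `x`: its pullback by the inverse chart. -/
def chartForm {k : ℕ} (θ : ∀ x : M, Tan E x [⋀^Fin k]→L[ℝ] ℝ) (x : M) (y : E) :
    E [⋀^Fin k]→L[ℝ] ℝ :=
  (θ ((extChartAt 𝓘(ℝ, E) x).symm y)).compContinuousLinearMap
    ((mfderiv 𝓘(ℝ, E) 𝓘(ℝ, E) (extChartAt 𝓘(ℝ, E) x).symm y).comp
      (NormedSpace.fromTangentSpace y).symm.toContinuousLinearMap)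

/-- The exterior derivative of a `k`-form on a manifold: at `x`, the exterior derivative of its
expression in the chart at `x`, pulled back by that chart. -/
def extD {k : ℕ} (θ : ∀ x : M, Tan E x [⋀^Fin k]→L[ℝ] ℝ) (x : M) :
    Tan E x [⋀^Fin (k + 1)]→L[ℝ] ℝ :=
  (extDeriv (chartForm θ x) (extChartAt 𝓘(ℝ, E) x x)).compContinuousLinearMap
    (mvfderiv 𝓘(ℝ, E) (extChartAt 𝓘(ℝ, E) x) x)

/-- The exterior derivative `dη` of a 1-form. -/
def dOne (η : ∀ x : M, Cot E x) (x : M) : Tan E x [⋀^Fin 2]→L[ℝ] ℝ :=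
  extD (fun y ↦ ContinuousAlternatingMap.ofSubsingleton ℝ (Tan E y) ℝ (0 : Fin 1) (η y)) x

/-- The interior product `i_v θ = θ(v, ·)` of a vector and a 2-form. -/
def int1 {x : M} (v : Tan E x) (θ : Tan E x [⋀^Fin 2]→L[ℝ] ℝ) : Cot E x :=
  θ.toContinuousMultilinearMap.toContinuousLinearMap ![v, 0] 1

@[simp] theorem int1_apply {x : M} (v w : Tan E x) (θ : Tan E x [⋀^Fin 2]→L[ℝ] ℝ) :
    int1 v θ w = θ ![v, w] := by
  simp only [int1, ContinuousMultilinearMap.toContinuousLinearMap_apply]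
  refine congrArg θ (funext fun i ↦ ?_)
  fin_cases i <;> rfl

/-- The contraction `i_{v ∧ w} θ = θ(v, w, ·)` of a 3-form. -/
def int2 {x : M} (v w : Tan E x) (θ : Tan E x [⋀^Fin 3]→L[ℝ] ℝ) : Cot E x :=
  θ.toContinuousMultilinearMap.toContinuousLinearMap ![v, w, 0] 2

@[simp] theorem int2_apply {x : M} (v w u : Tan E x) (θ : Tan E x [⋀^Fin 3]→L[ℝ] ℝ) :
    int2 v w θ u = θ ![v, w, u] := by
  simp only [int2, ContinuousMultilinearMap.toContinuousLinearMap_apply]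
  refine congrArg θ (funext fun i ↦ ?_)
  fin_cases i <;> rfl

/-- The Lie derivative of a 1-form along a vector field, `L_X η = i_X dη + d(i_X η)`. -/
def lieD (X : ∀ x : M, Tan E x) (η : ∀ x : M, Cot E x) (x : M) : Cot E x :=
  int1 (X x) (dOne η x) + mvfderiv 𝓘(ℝ, E) (fun y ↦ η y (X y)) x

/-- The Lie bracket of vector fields. -/
abbrev bracket (X Y : ∀ x : M, Tan E x) (x : M) : Tan E x :=
  _root_.VectorField.mlieBracket 𝓘(ℝ, E) X Y x

/-- The Nijenhuis tensor
`N_a(X, Y) = [aX, aY] + a²[X, Y] - a([aX, Y] + [X, aY])` of a (1,1)-tensor. -/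
def nijenhuis (a : ∀ x : M, Tan E x →L[ℝ] Tan E x) (X Y : ∀ x : M, Tan E x) (x : M) : Tan E x :=
  bracket (fun y ↦ a y (X y)) (fun y ↦ a y (Y y)) x + a x (a x (bracket X Y x))
    - a x (bracket (fun y ↦ a y (X y)) Y x + bracket X (fun y ↦ a y (Y y)) x)

/-- The Courant bracket of sections of `TM ⊕ T^*M`,
`[(X, ξ), (Y, η)] = ([X, Y], L_X η - L_Y ξ - ½ d(i_X η - i_Y ξ))`. -/
def courant (u v : ∀ x : M, GTan E x) (x : M) : GTan E x :=
  (bracket (fun y ↦ (u y).1) (fun y ↦ (v y).1) x,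
    lieD (fun y ↦ (u y).1) (fun y ↦ (v y).2) x - lieD (fun y ↦ (v y).1) (fun y ↦ (u y).2) x
      - (1 / 2 : ℝ) • mvfderiv 𝓘(ℝ, E) (fun y ↦ (v y).2 (u y).1 - (u y).2 (v y).1) x)

/-! ### Tensor fields and the endomorphism `J` -/

section Tensors

variable [IsManifold 𝓘(ℝ, E) ∞ M]

/-- The dual `a^* : T_x^*M → T_x^*M`, `a^*ξ = ξ ∘ a`. -/
def dual (a : EndoField E M) (x : M) : Cot E x →L[ℝ] Cot E x :=
  ContinuousLinearMap.precomp ℝ (a x)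

@[simp] theorem dual_apply (a : EndoField E M) (x : M) (ξ : Cot E x) (v : Tan E x) :
    dual a x ξ v = ξ (a x v) := rfl

/-- The bracket `[α, β]_π = L_{π^♯α} β - L_{π^♯β} α - d(π(α, β))` of 1-forms. -/
def piBracket (π : Bivector E M) (α β : OneForm E M) (x : M) : Cot E x :=
  lieD (fun y ↦ π.sharp y (α y)) (fun y ↦ β y) x - lieD (fun y ↦ π.sharp y (β y)) (fun y ↦ α y) x
    - mvfderiv 𝓘(ℝ, E) (fun y ↦ π.pair y (α y) (β y)) x

/-- The exterior derivative `dσ` of a 2-form. -/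
def TwoForm.d (σ : TwoForm E M) (x : M) : Tan E x [⋀^Fin 3]→L[ℝ] ℝ :=
  extD (fun y ↦ altOfBilin (σ.flat y) (σ.alternating y)) x

/-- The bilinear form `σ_a(v, w) = σ(av, w)`. -/
def TwoForm.twist (σ : TwoForm E M) (a : EndoField E M) (x : M) :
    Tan E x →L[ℝ] Tan E x →L[ℝ] ℝ :=
  (σ.flat x).comp (a x)

/-- `a^* σ_♯ = σ_♯ a`. -/
def TwoForm.Commutes (σ : TwoForm E M) (a : EndoField E M) : Prop :=
  ∀ x : M, (dual a x).comp (σ.flat x) = (σ.flat x).comp (a x)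

/-- If `a^* σ_♯ = σ_♯ a`, then `σ_a` is alternating. -/
theorem TwoForm.Commutes.twist_self {σ : TwoForm E M} {a : EndoField E M} (h : σ.Commutes a)
    (x : M) (v : Tan E x) : σ.twist a x v v = 0 := by
  have h1 : σ.flat x v (a x v) = σ.flat x (a x v) v :=
    DFunLike.congr_fun (DFunLike.congr_fun (h x) v) v
  have h2 := σ.alternating x (v + a x v)
  simp only [map_add, add_apply, σ.alternating] at h2
  show σ.flat x (a x v) v = 0
  linarith

/-- The exterior derivative `dσ_a` of the 2-form `σ_a(X, Y) = σ(aX, Y)`. -/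
def TwoForm.dTwist {σ : TwoForm E M} {a : EndoField E M} (h : σ.Commutes a) (x : M) :
    Tan E x [⋀^Fin 3]→L[ℝ] ℝ :=
  extD (fun y ↦ altOfBilin (σ.twist a y) (h.twist_self y)) x

/-- The endomorphism `(v, ξ) ↦ (a v + π^♯ ξ, σ_♯ v - a^* ξ)` of `TM ⊕ T^*M`, with block matrix
`(a, π^♯; σ_♯, -a^*)`. -/
def blockEndo (a : EndoField E M) (π : Bivector E M) (σ : TwoForm E M) (x : M) :
    GTan E x →L[ℝ] GTan E x :=
  ((a x).comp (ContinuousLinearMap.fst ℝ _ _) +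
      (π.sharp x).comp (ContinuousLinearMap.snd ℝ _ _)).prod
    ((σ.flat x).comp (ContinuousLinearMap.fst ℝ _ _) -
      (dual a x).comp (ContinuousLinearMap.snd ℝ _ _))

theorem blockEndo_apply (a : EndoField E M) (π : Bivector E M) (σ : TwoForm E M) (x : M)
    (v : Tan E x) (ξ : Cot E x) :
    blockEndo a π σ x (v, ξ) = (a x v + π.sharp x ξ, σ.flat x v - dual a x ξ) := rfl

/-- The smooth section `(X, ξ)` of `TM ⊕ T^*M`. -/
def sec (X : VectorField E M) (ξ : OneForm E M) (x : M) : GTan E x := (X x, ξ x)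

/-- `J` is a generalized almost subtangent structure: `J² = 0`. -/
def IsAlmostSubtangent (J : ∀ x : M, GTan E x →L[ℝ] GTan E x) : Prop :=
  ∀ x : M, (J x).comp (J x) = 0

/-- `J` is integrable for the Courant bracket:
`[Ju, Jv] - J([Ju, v] + [u, Jv]) = 0` for all smooth sections `u`, `v` of `TM ⊕ T^*M`. -/
def IsIntegrable (J : ∀ x : M, GTan E x →L[ℝ] GTan E x) : Prop :=
  ∀ (X Y : VectorField E M) (ξ η : OneForm E M) (x : M),
    courant (fun y ↦ J y (sec X ξ y)) (fun y ↦ J y (sec Y η y)) x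
      - J x (courant (fun y ↦ J y (sec X ξ y)) (sec Y η) x
          + courant (sec X ξ) (fun y ↦ J y (sec Y η y)) x) = 0

/-- `J` is a generalized subtangent structure: `J² = 0` and `J` is integrable. -/
def IsSubtangent (J : ∀ x : M, GTan E x →L[ℝ] GTan E x) : Prop :=
  IsAlmostSubtangent J ∧ IsIntegrable J

end Tensors

end GenGeom

end

/-! The block equation `J² = 0` has four entries. Three are the algebraic parts of (S2), (S3) and
(S4), and the fourth is the transpose of the (S3) entry because `π` and `σ` are skew
(`isAlmostSubtangent_blockEndo_iff`).

For integrability, the concomitant `[Ju, Jv] - J([Ju, v] + [u, Jv])` is biadditive and skew, so it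
is determined by its values on two vector fields, on a mixed pair, and on two 1-forms. Once the
algebraic identities are known, the components of these values are the differential defects. Two
1-forms give the defects of (S1) and (S2). Two vector fields give those of (S3) and (S4). A mixed
pair gives the (S2) defect again when its vector part is paired with `ξ`, and the (S3) defect again
when its covector part is evaluated on `Y`. The mixed case therefore adds no condition.

Each value is computed by testing against vector fields and expanding `d` and the Lie derivative
with Cartan formulas, which come from the flat case through the chart at the point (`extD_apply`).
Only differentiability at that point is needed, so the test fields may be local. Global smooth
sections through a prescribed vector (`exists_section`) turn the conditions on smooth fields back
into pointwise vanishing. -/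

noncomputable section

namespace GenGeom

/-! ### Differentiability of families of alternating forms -/

section Evaluation

variable {E : Type*} [NormedAddCommGroup E] [NormedSpace ℝ E] [FiniteDimensional ℝ E]

/-- On a finite-dimensional space, a family of alternating forms is differentiable as soon as all
its evaluations are. -/
theorem differentiableAt_of_forall_apply {k : ℕ} {φ : E → E [⋀^Fin k]→L[ℝ] ℝ} {y : E}
    (h : ∀ v, DifferentiableAt ℝ (fun z ↦ φ z v) y) : DifferentiableAt ℝ φ y := by
  -- Evaluations on tuples of basis vectors separate forms, so `φ` is recovered from finitely many
  -- scalar functions by a linear left inverse.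
  let b := Module.finBasis ℝ E
  let L : (E [⋀^Fin k]→L[ℝ] ℝ) →ₗ[ℝ] ((Fin k → Fin (Module.finrank ℝ E)) → ℝ) :=
    { toFun := fun f s ↦ f fun i ↦ b (s i)
      map_add' := fun _ _ ↦ rfl
      map_smul' := fun _ _ ↦ rfl }
  have hL : LinearMap.ker L = ⊥ := by
    refine LinearMap.ker_eq_bot'.2 fun f hf ↦ ?_
    refine ContinuousAlternatingMap.toContinuousMultilinearMap_injective
      (ContinuousMultilinearMap.toMultilinearMap_injective ?_)
    exact Module.Basis.ext_multilinear (fun _ ↦ b) fun s ↦ congrFun hf s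
  obtain ⟨g, hg⟩ := L.exists_leftInverse_of_injective hL
  have : φ = fun z ↦ LinearMap.toContinuousLinearMap g (L (φ z)) :=
    funext fun z ↦ (LinearMap.congr_fun hg (φ z)).symm
  rw [this]
  exact (LinearMap.toContinuousLinearMap g).differentiableAt.comp y
    (differentiableAt_pi.2 fun s ↦ h _)

end Evaluation

/-! ### The exterior derivative through charts -/

variable {E : Type*} [NormedAddCommGroup E] [NormedSpace ℝ E]
  {M : Type*} [TopologicalSpace M] [ChartedSpace E M] [IsManifold 𝓘(ℝ, E) ∞ M]

/-- A vector field is differentiable at `x`. -/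
abbrev VDiffAt (X : ∀ x : M, Tan E x) (x : M) : Prop :=
  MDifferentiableAt 𝓘(ℝ, E) 𝓘(ℝ, E).tangent
    (fun m ↦ (⟨m, X m⟩ : TangentBundle 𝓘(ℝ, E) M)) x

/-- A `k`-form is differentiable at `x` when tested against vector fields. -/
def FormDiffAt {k : ℕ} (θ : ∀ x : M, Tan E x [⋀^Fin k]→L[ℝ] ℝ) (x : M) : Prop :=
  ∀ V : Fin k → ∀ m : M, Tan E m, (∀ i, VDiffAt (V i) x) →
    MDifferentiableAt 𝓘(ℝ, E) 𝓘(ℝ) (fun m ↦ θ m fun i ↦ V i m) x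

/-- The expression of a vector field in the chart at `x`. -/
def chartField (x : M) (X : ∀ m : M, Tan E m) : E → E :=
  _root_.VectorField.mpullbackWithin 𝓘(ℝ, E) 𝓘(ℝ, E) (extChartAt 𝓘(ℝ, E) x).symm X
    (Set.range 𝓘(ℝ, E))

theorem differentiableAt_chartField [CompleteSpace E] {x : M} {X : ∀ m : M, Tan E m}
    (hX : VDiffAt X x) : DifferentiableAt ℝ (chartField x X) (extChartAt 𝓘(ℝ, E) x x) := by
  have := (mdifferentiableWithinAt_univ.2 hX).differentiableWithinAt_mpullbackWithin_vectorField
  simpa [chartField] using this.differentiableAt (by simp)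

/-- The chart at `x` has identity derivative at `x` itself, so the pullback in the manifold bracket
disappears there. -/
theorem bracket_eq_lieBracket (x : M) (X Y : ∀ m : M, Tan E m) :
    bracket X Y x = _root_.VectorField.lieBracket ℝ (chartField x X) (chartField x Y)
      (extChartAt 𝓘(ℝ, E) x x) := by
  have h := _root_.VectorField.mlieBracketWithin_apply (I := 𝓘(ℝ, E)) (V := X) (W := Y)
    (s := Set.univ) (x₀ := x)
  rw [mfderiv_extChartAt_self, _root_.VectorField.mlieBracketWithin_univ] at h
  refine h.trans ((DFunLike.congr_fun (ContinuousLinearMap.inverse_id (R := ℝ) (M := E)) _).trans ?_)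
  rw [← _root_.VectorField.lieBracketWithin_univ]
  simp only [chartField, Set.preimage_univ, Set.univ_inter, modelWithCornersSelf_coe, Set.range_id]
  exact ContinuousLinearMap.id_apply (R₁ := ℝ) (M₁ := E) _

omit [IsManifold 𝓘(ℝ, E) ∞ M] in
theorem MDifferentiableAt.differentiableAt_comp_chart {f : M → ℝ} {x : M}
    (hf : MDifferentiableAt 𝓘(ℝ, E) 𝓘(ℝ) f x) :
    DifferentiableAt ℝ (fun y ↦ f ((extChartAt 𝓘(ℝ, E) x).symm y)) (extChartAt 𝓘(ℝ, E) x x) := by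
  have h := (mdifferentiableWithinAt_iff.1 (mdifferentiableWithinAt_univ.2 hf)).2
  simp only [Set.preimage_univ, Set.univ_inter, modelWithCornersSelf_coe, Set.range_id] at h
  exact h.differentiableAt (by simp)

/-- The derivative of the inverse chart used to pull back the form cancels the inverse derivative
used to pull back the fields. -/
theorem chartForm_chartField {k : ℕ} (θ : ∀ x : M, Tan E x [⋀^Fin k]→L[ℝ] ℝ) (x : M)
    (V : Fin k → ∀ m : M, Tan E m) {y : E} (hy : y ∈ (extChartAt 𝓘(ℝ, E) x).target) :
    chartForm θ x y (fun i ↦ chartField x (V i) y) =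
      θ ((extChartAt 𝓘(ℝ, E) x).symm y) fun i ↦ V i ((extChartAt 𝓘(ℝ, E) x).symm y) := by
  have hinv := isInvertible_mfderivWithin_extChartAt_symm (I := 𝓘(ℝ, E)) hy
  unfold chartForm
  rw [ContinuousAlternatingMap.compContinuousLinearMap_apply]
  congr 1
  funext i
  simp only [chartField, _root_.VectorField.mpullbackWithin_apply]
  rw [← mfderivWithin_univ, ← (show Set.range 𝓘(ℝ, E) = Set.univ by simp)]
  exact DFunLike.congr_fun hinv.self_comp_inverse (V i ((extChartAt 𝓘(ℝ, E) x).symm y))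

theorem chartField_self (x : M) (X : ∀ m : M, Tan E m) :
    chartField x X (extChartAt 𝓘(ℝ, E) x x) = X x := by
  simp only [chartField, _root_.VectorField.mpullbackWithin_apply]
  rw [mfderivWithin_range_extChartAt_symm]
  refine (DFunLike.congr_fun (ContinuousLinearMap.inverse_id (R := ℝ) (M := E)) _).trans ?_
  -- The base point returned by the inverse chart is only propositionally `x`, so the fibres are
  -- compared inside `E`.
  have key : ∀ z : M, z = x → (show E from X z) = X x := fun z hz ↦ by subst hz; rfl
  exact key _ (extChartAt_to_inv x)

/-- The local vector field which is constant in the chart at `x`. -/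
def constField (x : M) (v : E) (m : M) : Tan E m :=
  (trivializationAt E (TangentSpace 𝓘(ℝ, E) : M → Type _) x).symmL ℝ m v

theorem vDiffAt_constField (x : M) (v : E) : VDiffAt (constField x v) x := by
  refine (mdifferentiableAt_section 𝓘(ℝ, E) _).2 ?_
  refine (mdifferentiableAt_const (c := v)).congr_of_eventuallyEq ?_
  set t := trivializationAt E (TangentSpace 𝓘(ℝ, E) : M → Type _) x
  filter_upwards [t.open_baseSet.mem_nhds (FiberBundle.mem_baseSet_trivializationAt' x)] with m hm
  have h := t.continuousLinearMapAt_symmL (R := ℝ) hm v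
  rwa [t.continuousLinearMapAt_apply ℝ, t.coe_linearMapAt_of_mem hm] at h

theorem chartField_constField (x : M) (v : E) {y : E} (hy : y ∈ (extChartAt 𝓘(ℝ, E) x).target) :
    chartField x (constField x v) y = v := by
  have hinv := isInvertible_mfderivWithin_extChartAt_symm (I := 𝓘(ℝ, E)) hy
  have hs : (extChartAt 𝓘(ℝ, E) x).symm y ∈ (chartAt E x).source := by
    simpa using (extChartAt 𝓘(ℝ, E) x).map_target hy
  simp only [chartField, constField, _root_.VectorField.mpullbackWithin_apply]
  rw [TangentBundle.symmL_trivializationAt hs, (extChartAt 𝓘(ℝ, E) x).right_inv hy]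
  exact DFunLike.congr_fun hinv.inverse_comp_self v

/-- Coordinate-constant fields turn each evaluation of the chart expression into a function `θ(V)`
read in the chart, to which the hypothesis applies. -/
theorem differentiableAt_chartForm {k : ℕ} [FiniteDimensional ℝ E]
    {θ : ∀ x : M, Tan E x [⋀^Fin k]→L[ℝ] ℝ} {x : M} (hθ : FormDiffAt θ x) :
    DifferentiableAt ℝ (chartForm θ x) (extChartAt 𝓘(ℝ, E) x x) := by
  refine differentiableAt_of_forall_apply fun v ↦ ?_
  let V : Fin k → ∀ m : M, Tan E m := fun i ↦ constField x (v i)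
  have h := MDifferentiableAt.differentiableAt_comp_chart
    (hθ V fun i ↦ vDiffAt_constField x (v i))
  refine h.congr_of_eventuallyEq ?_
  filter_upwards [extChartAt_target_mem_nhds (I := 𝓘(ℝ, E)) x] with y hy
  rw [← chartForm_chartField θ x V hy]
  congr 1
  funext i
  exact (chartField_constField x (v i) hy).symm

omit [IsManifold 𝓘(ℝ, E) ∞ M] in
theorem mvfderiv_eq_fderiv {f : M → ℝ} {x : M} (hf : MDifferentiableAt 𝓘(ℝ, E) 𝓘(ℝ) f x)
    (v : Tan E x) :
    mvfderiv 𝓘(ℝ, E) f x v =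
      fderiv ℝ (fun y ↦ f ((extChartAt 𝓘(ℝ, E) x).symm y)) (extChartAt 𝓘(ℝ, E) x x) v := by
  simp [mvfderiv, mfderiv, hf]
  rfl

/-- The invariant formula for `d`, carried over from `E` by pulling back both form and fields. A
pair `i ≤ j` stands for the slots `i < j + 1`; this shift explains the sign of the bracket terms. -/
theorem extD_apply [FiniteDimensional ℝ E] {n : ℕ} {θ : ∀ x : M, Tan E x [⋀^Fin (n + 1)]→L[ℝ] ℝ}
    {x : M} (hθ : FormDiffAt θ x) {V : Fin (n + 2) → ∀ m : M, Tan E m}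
    (hV : ∀ i, VDiffAt (V i) x) :
    extD θ x (fun i ↦ V i x) =
      (∑ i, (-1) ^ i.val • mvfderiv 𝓘(ℝ, E) (fun m ↦ θ m (i.removeNth fun j ↦ V j m)) x (V i x)) -
        ∑ i : Fin (n + 1), ∑ j ≥ i, (-1) ^ (i + j : ℕ) •
          θ x (Matrix.vecCons (bracket (V i.castSucc) (V j.succ) x)
            (j.removeNth <| i.castSucc.removeNth fun j ↦ V j x)) := by
  have hD : extD θ x (fun i ↦ V i x) = extDeriv (chartForm θ x) (extChartAt 𝓘(ℝ, E) x x)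
      fun i ↦ chartField x (V i) (extChartAt 𝓘(ℝ, E) x x) := by
    unfold extD
    rw [ContinuousAlternatingMap.compContinuousLinearMap_apply]
    congr 1
    funext i
    rw [chartField_self]
    exact DFunLike.congr_fun (mfderiv_extChartAt_self (I := 𝓘(ℝ, E)) (x := x)) (V i x)
  have hself : ∀ w : Fin (n + 1) → Tan E x,
      chartForm θ x (extChartAt 𝓘(ℝ, E) x x) w = θ x w := fun w ↦ by
    have h := chartForm_chartField θ x (fun i ↦ constField (E := E) x (w i)) (mem_extChartAt_target x)
    have key : ∀ z : M, z = x → (θ z fun i ↦ constField (E := E) x (w i) z) = θ x w := by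
      rintro z rfl
      congr 1
      funext i
      exact (chartField_self z (constField (E := E) z (w i))).symm.trans
        (chartField_constField (E := E) z (w i) (mem_extChartAt_target z))
    rw [← key _ (extChartAt_to_inv (I := 𝓘(ℝ, E)) x), ← h]
    congr 1
    funext i
    exact (chartField_constField (E := E) x (w i) (mem_extChartAt_target x)).symm
  rw [hD, extDeriv_apply_vectorField (differentiableAt_chartForm hθ)
    fun i ↦ differentiableAt_chartField (hV i)]
  congr 1
  · refine Finset.sum_congr rfl fun i _ ↦ ?_
    congr 1
    rw [chartField_self]
    refine Eq.trans ?_ (mvfderiv_eq_fderiv (hθ (i.removeNth V) fun j ↦ hV _) _).symm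
    refine DFunLike.congr_fun (Filter.EventuallyEq.fderiv_eq ?_) _
    filter_upwards [extChartAt_target_mem_nhds (I := 𝓘(ℝ, E)) x] with y hy
    exact chartForm_chartField θ x (i.removeNth V) hy
  · refine Finset.sum_congr rfl fun i _ ↦ Finset.sum_congr rfl fun j _ ↦ ?_
    congr 1
    rw [bracket_eq_lieBracket, ← hself]
    simp only [chartField_self]
    rfl

end GenGeom

end

noncomputable section

namespace GenGeom

variable {E : Type*} [NormedAddCommGroup E] [NormedSpace ℝ E]
  {M : Type*} [TopologicalSpace M] [ChartedSpace E M] [IsManifold 𝓘(ℝ, E) ∞ M]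

/-! ### Differentiable fields and their pairings -/

/-- A 1-form is differentiable at `x` when tested against vector fields. -/
def CDiffAt (η : ∀ x : M, Cot E x) (x : M) : Prop :=
  ∀ X : ∀ m : M, Tan E m, VDiffAt X x →
    MDifferentiableAt 𝓘(ℝ, E) 𝓘(ℝ) (fun m ↦ η m (X m)) x

theorem vDiffAt_section (X : VectorField E M) (x : M) : VDiffAt (fun m ↦ X m) x :=
  X.mdifferentiableAt

omit [IsManifold 𝓘(ℝ, E) ∞ M] in
theorem mdifferentiableAt_of_trivial {f : M → ℝ} {x : M}
    (h : MDifferentiableAt 𝓘(ℝ, E) (𝓘(ℝ, E).prod 𝓘(ℝ))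
      (fun m ↦ Bundle.TotalSpace.mk' ℝ (E := Bundle.Trivial M ℝ) m (f m)) x) :
    MDifferentiableAt 𝓘(ℝ, E) 𝓘(ℝ) f x :=
  (mdifferentiableAt_section 𝓘(ℝ, E) _).1 h

theorem cDiffAt_section (η : OneForm E M) (x : M) : CDiffAt (fun m ↦ η m) x := fun _ hX ↦
  mdifferentiableAt_of_trivial <|
    MDifferentiableAt.clm_bundle_apply (E₂ := Bundle.Trivial M ℝ) η.mdifferentiableAt hX

theorem vDiffAt_endo (a : EndoField E M) {X : ∀ m : M, Tan E m} {x : M} (hX : VDiffAt X x) :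
    VDiffAt (fun m ↦ a m (X m)) x :=
  MDifferentiableAt.clm_bundle_apply a.mdifferentiableAt hX

theorem vDiffAt_sharp (π : Bivector E M) (ξ : OneForm E M) (x : M) :
    VDiffAt (fun m ↦ π.sharp m (ξ m)) x :=
  MDifferentiableAt.clm_bundle_apply (F₁ := E →L[ℝ] ℝ) (E₁ := fun m : M ↦ Cot E m)
    π.sharp.mdifferentiableAt ξ.mdifferentiableAt

theorem mdifferentiableAt_flat (σ : TwoForm E M) {X Y : ∀ m : M, Tan E m} {x : M}
    (hX : VDiffAt X x) (hY : VDiffAt Y x) :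
    MDifferentiableAt 𝓘(ℝ, E) 𝓘(ℝ) (fun m ↦ σ.flat m (X m) (Y m)) x :=
  mdifferentiableAt_of_trivial <|
    MDifferentiableAt.clm_bundle_apply₂ (E₃ := Bundle.Trivial M ℝ) σ.flat.mdifferentiableAt hX hY

theorem cDiffAt_flat (σ : TwoForm E M) {X : ∀ m : M, Tan E m} {x : M} (hX : VDiffAt X x) :
    CDiffAt (fun m ↦ σ.flat m (X m)) x :=
  fun _ hY ↦ mdifferentiableAt_flat σ hX hY

theorem cDiffAt_dual (a : EndoField E M) {η : ∀ m : M, Cot E m} {x : M} (hη : CDiffAt η x) :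
    CDiffAt (fun m ↦ dual a m (η m)) x :=
  fun _ hY ↦ hη _ (vDiffAt_endo a hY)

theorem VDiffAt.add {X Y : ∀ m : M, Tan E m} {x : M} (hX : VDiffAt X x) (hY : VDiffAt Y x) :
    VDiffAt (fun m ↦ X m + Y m) x :=
  mdifferentiableAt_add_section hX hY

theorem CDiffAt.add {ξ η : ∀ m : M, Cot E m} {x : M} (hξ : CDiffAt ξ x) (hη : CDiffAt η x) :
    CDiffAt (fun m ↦ ξ m + η m) x :=
  fun X hX ↦ (hξ X hX).add (hη X hX)

theorem exists_vDiffAt (x : M) (v : Tan E x) : ∃ X : ∀ m : M, Tan E m, VDiffAt X x ∧ X x = v :=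
  ⟨FiberBundle.extend E v, FiberBundle.mdifferentiableAt_extend 𝓘(ℝ, E) E v,
    FiberBundle.extend_apply_self E v⟩

section Extension

variable {F : Type*} [NormedAddCommGroup F] [NormedSpace ℝ F] {V : M → Type*}
  [TopologicalSpace (Bundle.TotalSpace F V)] [∀ x, AddCommGroup (V x)] [∀ x, Module ℝ (V x)]
  [∀ x, TopologicalSpace (V x)] [FiberBundle F V] [VectorBundle ℝ F V]
  [ContMDiffVectorBundle ∞ F V 𝓘(ℝ, E)]

/-- Every vector of a fibre of a smooth vector bundle is the value of a global smooth section. -/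
theorem exists_section [FiniteDimensional ℝ E] [T2Space M] (x : M) (v : V x) :
    ∃ s : ContMDiffSection 𝓘(ℝ, E) F ∞ V, s x = v := by
  obtain ⟨u, hu, hs⟩ := FiberBundle.exists_contMDiffOn_extend (k := ∞) 𝓘(ℝ, E) F v
  obtain ⟨w, hwu, hw, hxw⟩ := mem_nhds_iff.1 hu
  -- The extension is smooth only near `x`; a bump function supported there and equal to 1 at `x`
  -- makes it global.
  obtain ⟨f, -, hf⟩ := (SmoothBumpFunction.nhds_basis_tsupport (I := 𝓘(ℝ, E)) x).mem_iff.1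
    (hw.mem_nhds hxw)
  refine ⟨⟨fun m ↦ f m • FiberBundle.extend F v m, ?_⟩, ?_⟩
  · exact ContMDiffOn.smul_section_of_tsupport f.contMDiff.contMDiffOn hw hf (hs.mono hwu)
  · change f x • FiberBundle.extend F v x = v
    rw [f.eq_one, one_smul, FiberBundle.extend_apply_self]

end Extension

/-! ### Cartan formulas -/

theorem signed_sum_two (c : Fin 2 → ℝ) (d : Fin 1 → Fin 1 → ℝ) :
    (∑ i, (-1) ^ i.val • c i) - ∑ i : Fin 1, ∑ j ≥ i, (-1) ^ (i + j : ℕ) • d i j =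
      c 0 - c 1 - d 0 0 := by
  have h0 : Finset.Ici (0 : Fin 1) = {0} := by decide
  simp [Fin.sum_univ_two, h0, sub_eq_add_neg]

theorem signed_sum_three (c : Fin 3 → ℝ) (d : Fin 2 → Fin 2 → ℝ) :
    (∑ i, (-1) ^ i.val • c i) - ∑ i : Fin 2, ∑ j ≥ i, (-1) ^ (i + j : ℕ) • d i j =
      c 0 - c 1 + c 2 - d 0 0 + d 0 1 - d 1 1 := by
  have h0 : Finset.Ici (0 : Fin 2) = {0, 1} := by decide
  have h1 : Finset.Ici (1 : Fin 2) = {1} := by decide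
  simp [Fin.sum_univ_two, Fin.sum_univ_three, h0, h1]
  ring

variable [FiniteDimensional ℝ E]

theorem dOne_apply {η : ∀ m : M, Cot E m} {X Y : ∀ m : M, Tan E m} {x : M} (hη : CDiffAt η x)
    (hX : VDiffAt X x) (hY : VDiffAt Y x) :
    dOne η x ![X x, Y x] = mvfderiv 𝓘(ℝ, E) (fun m ↦ η m (Y m)) x (X x)
      - mvfderiv 𝓘(ℝ, E) (fun m ↦ η m (X m)) x (Y x) - η x (bracket X Y x) := by
  have h := extD_apply
    (θ := fun y ↦ ContinuousAlternatingMap.ofSubsingleton ℝ (Tan E y) ℝ (0 : Fin 1) (η y))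
    (x := x) (fun V hV ↦ hη _ (hV 0)) (V := ![X, Y]) (by
      intro i; fin_cases i; exacts [hX, hY])
  have hv : (fun i ↦ (![X, Y] : Fin 2 → ∀ m : M, Tan E m) i x) = ![X x, Y x] := by
    funext i; fin_cases i <;> rfl
  rw [hv] at h
  exact h.trans (signed_sum_two _ _)

theorem extD_altOfBilin_apply {B : ∀ x : M, Tan E x →L[ℝ] Tan E x →L[ℝ] ℝ}
    (hB : ∀ x v, B x v v = 0) {x : M}
    (hd : ∀ X Y : ∀ m : M, Tan E m, VDiffAt X x → VDiffAt Y x →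
      MDifferentiableAt 𝓘(ℝ, E) 𝓘(ℝ) (fun m ↦ B m (X m) (Y m)) x)
    {X Y Z : ∀ m : M, Tan E m} (hX : VDiffAt X x) (hY : VDiffAt Y x) (hZ : VDiffAt Z x) :
    extD (fun y ↦ altOfBilin (B y) (hB y)) x ![X x, Y x, Z x] =
      mvfderiv 𝓘(ℝ, E) (fun m ↦ B m (Y m) (Z m)) x (X x)
        - mvfderiv 𝓘(ℝ, E) (fun m ↦ B m (X m) (Z m)) x (Y x)
        + mvfderiv 𝓘(ℝ, E) (fun m ↦ B m (X m) (Y m)) x (Z x)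
        - B x (bracket X Y x) (Z x) + B x (bracket X Z x) (Y x) - B x (bracket Y Z x) (X x) := by
  have h := extD_apply (θ := fun y ↦ altOfBilin (B y) (hB y)) (x := x)
    (fun V hV ↦ hd _ _ (hV 0) (hV 1)) (V := ![X, Y, Z]) (by
      intro i; fin_cases i; exacts [hX, hY, hZ])
  have hv : (fun i ↦ (![X, Y, Z] : Fin 3 → ∀ m : M, Tan E m) i x) = ![X x, Y x, Z x] := by
    funext i; fin_cases i <;> rfl
  rw [hv] at h
  exact h.trans (signed_sum_three _ _)

theorem lieD_apply {X Y : ∀ m : M, Tan E m} {η : ∀ m : M, Cot E m} {x : M} (hη : CDiffAt η x)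
    (hX : VDiffAt X x) (hY : VDiffAt Y x) :
    lieD X η x (Y x) = mvfderiv 𝓘(ℝ, E) (fun m ↦ η m (Y m)) x (X x) - η x (bracket X Y x) := by
  simp only [lieD, add_apply, int1_apply, dOne_apply hη hX hY]
  ring

end GenGeom

end

noncomputable section

namespace GenGeom

variable {E : Type*} [NormedAddCommGroup E] [NormedSpace ℝ E]
  {M : Type*} [TopologicalSpace M] [ChartedSpace E M] [IsManifold 𝓘(ℝ, E) ∞ M]

/-! ### The Courant bracket on differentiable sections -/

theorem vDiffAt_zero (x : M) : VDiffAt (fun m : M ↦ (0 : Tan E m)) x :=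
  vDiffAt_section 0 x

theorem cDiffAt_zero (x : M) : CDiffAt (fun m : M ↦ (0 : Cot E m)) x :=
  fun _ _ ↦ mdifferentiableAt_const

omit [IsManifold 𝓘(ℝ, E) ∞ M] in
@[simp] theorem bracket_zero_left (Y : ∀ m : M, Tan E m) (x : M) :
    bracket (fun m : M ↦ (0 : Tan E m)) Y x = 0 :=
  congrFun (_root_.VectorField.mlieBracket_zero_left (I := 𝓘(ℝ, E)) (W := Y)) x

omit [IsManifold 𝓘(ℝ, E) ∞ M] in
@[simp] theorem bracket_zero_right (Y : ∀ m : M, Tan E m) (x : M) :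
    bracket Y (fun m : M ↦ (0 : Tan E m)) x = 0 :=
  congrFun (_root_.VectorField.mlieBracket_zero_right (I := 𝓘(ℝ, E)) (W := Y)) x

omit [IsManifold 𝓘(ℝ, E) ∞ M] in
theorem bracket_swap (X Y : ∀ m : M, Tan E m) (x : M) : bracket X Y x = -bracket Y X x :=
  _root_.VectorField.mlieBracket_swap_apply

omit [IsManifold 𝓘(ℝ, E) ∞ M] in
@[simp] theorem mvfderiv_zero_fun (x : M) : mvfderiv 𝓘(ℝ, E) (fun _ : M ↦ (0 : ℝ)) x = 0 :=
  mvfderiv_const 0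

omit [IsManifold 𝓘(ℝ, E) ∞ M] in
theorem mvfderiv_neg_apply {f g : M → ℝ} (h : ∀ m, f m = -g m) (x : M) (v : Tan E x) :
    mvfderiv 𝓘(ℝ, E) f x v = -mvfderiv 𝓘(ℝ, E) g x v := by
  have : f = -g := funext h
  rw [this, mvfderiv_neg]
  rfl

omit [IsManifold 𝓘(ℝ, E) ∞ M] in
theorem mvfderiv_add_apply {f g : M → ℝ} {x : M} (hf : MDifferentiableAt 𝓘(ℝ, E) 𝓘(ℝ) f x)
    (hg : MDifferentiableAt 𝓘(ℝ, E) 𝓘(ℝ) g x) (v : Tan E x) :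
    mvfderiv 𝓘(ℝ, E) (fun m ↦ f m + g m) x v =
      mvfderiv 𝓘(ℝ, E) f x v + mvfderiv 𝓘(ℝ, E) g x v :=
  DFunLike.congr_fun (mvfderiv_add hf hg) v

omit [IsManifold 𝓘(ℝ, E) ∞ M] in
theorem mvfderiv_sub_apply {f g : M → ℝ} {x : M} (hf : MDifferentiableAt 𝓘(ℝ, E) 𝓘(ℝ) f x)
    (hg : MDifferentiableAt 𝓘(ℝ, E) 𝓘(ℝ) g x) (v : Tan E x) :
    mvfderiv 𝓘(ℝ, E) (fun m ↦ f m - g m) x v =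
      mvfderiv 𝓘(ℝ, E) f x v - mvfderiv 𝓘(ℝ, E) g x v :=
  DFunLike.congr_fun (mvfderiv_sub hf hg) v

/-- A section of `TM ⊕ T^*M` is differentiable at `x`. -/
structure GDiffAt (u : ∀ m : M, GTan E m) (x : M) : Prop where
  fst : VDiffAt (fun m ↦ (u m).1) x
  snd : CDiffAt (fun m ↦ (u m).2) x

theorem GDiffAt.add {u v : ∀ m : M, GTan E m} {x : M} (hu : GDiffAt u x) (hv : GDiffAt v x) :
    GDiffAt (fun m ↦ u m + v m) x :=
  ⟨hu.fst.add hv.fst, hu.snd.add hv.snd⟩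

/-- Every tangent vector extends to a field differentiable at `x`, so identities of covectors reduce
to Cartan expansions. -/
theorem cot_ext {x : M} {α β : Cot E x}
    (h : ∀ Z : ∀ m : M, Tan E m, VDiffAt Z x → α (Z x) = β (Z x)) : α = β := by
  refine ContinuousLinearMap.ext fun v ↦ ?_
  obtain ⟨Z, hZ, rfl⟩ := exists_vDiffAt x v
  exact h Z hZ

omit [IsManifold 𝓘(ℝ, E) ∞ M] in
theorem courant_swap (u v : ∀ m : M, GTan E m) (x : M) : courant u v x = -courant v u x := by
  refine Prod.ext (bracket_swap _ _ x) ?_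
  refine ContinuousLinearMap.ext fun w ↦ ?_
  have h := mvfderiv_neg_apply (E := E) (f := fun y ↦ (v y).2 (u y).1 - (u y).2 (v y).1)
    (g := fun y ↦ (u y).2 (v y).1 - (v y).2 (u y).1) (fun m ↦ by ring) x w
  simp only [courant, Prod.snd_neg, neg_apply, sub_apply, smul_apply, smul_eq_mul, h]
  ring

theorem CDiffAt.neg {ξ : ∀ m : M, Cot E m} {x : M} (hξ : CDiffAt ξ x) :
    CDiffAt (fun m ↦ -ξ m) x :=
  fun X hX ↦ (hξ X hX).neg

variable [FiniteDimensional ℝ E]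

theorem courant_snd_apply {X Y Z : ∀ m : M, Tan E m} {ξ η : ∀ m : M, Cot E m} {x : M}
    (hX : VDiffAt X x) (hξ : CDiffAt ξ x) (hY : VDiffAt Y x) (hη : CDiffAt η x)
    (hZ : VDiffAt Z x) :
    (courant (fun m ↦ (X m, ξ m)) (fun m ↦ (Y m, η m)) x).2 (Z x) =
      mvfderiv 𝓘(ℝ, E) (fun m ↦ η m (Z m)) x (X x) - η x (bracket X Z x)
        - mvfderiv 𝓘(ℝ, E) (fun m ↦ ξ m (Z m)) x (Y x) + ξ x (bracket Y Z x)
        - 1 / 2 * (mvfderiv 𝓘(ℝ, E) (fun m ↦ η m (X m)) x (Z x)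
          - mvfderiv 𝓘(ℝ, E) (fun m ↦ ξ m (Y m)) x (Z x)) := by
  simp only [courant, sub_apply, smul_apply, smul_eq_mul, lieD_apply hη hX hZ,
    lieD_apply hξ hY hZ, mvfderiv_sub_apply (hη X hX) (hξ Y hY)]
  ring

theorem courant_add_left {u u' v : ∀ m : M, GTan E m} {x : M} (hu : GDiffAt u x)
    (hu' : GDiffAt u' x) (hv : GDiffAt v x) :
    courant (fun m ↦ u m + u' m) v x = courant u v x + courant u' v x := by
  have h1 : bracket (fun m ↦ (u m).1 + (u' m).1) (fun m ↦ (v m).1) x =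
      bracket (fun m ↦ (u m).1) (fun m ↦ (v m).1) x
        + bracket (fun m ↦ (u' m).1) (fun m ↦ (v m).1) x :=
    _root_.VectorField.mlieBracket_add_left hu.fst hu'.fst
  refine Prod.ext h1 ?_
  refine cot_ext fun Z hZ ↦ ?_
  have e1 := courant_snd_apply hu.fst hu.snd hv.fst hv.snd hZ
  have e2 := courant_snd_apply hu'.fst hu'.snd hv.fst hv.snd hZ
  have e3 := courant_snd_apply (hu.add hu').fst (hu.add hu').snd hv.fst hv.snd hZ
  have h2 : bracket (fun m ↦ (u m).1 + (u' m).1) Z x =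
      bracket (fun m ↦ (u m).1) Z x + bracket (fun m ↦ (u' m).1) Z x :=
    _root_.VectorField.mlieBracket_add_left hu.fst hu'.fst
  simp only [Prod.fst_add, Prod.snd_add, add_apply, map_add, h2,
    mvfderiv_add_apply (hu.snd _ hZ) (hu'.snd _ hZ),
    mvfderiv_add_apply (hu.snd _ hv.fst) (hu'.snd _ hv.fst),
    mvfderiv_add_apply (hv.snd _ hu.fst) (hv.snd _ hu'.fst)] at e1 e2 e3 ⊢
  refine e3.trans ?_
  refine Eq.trans ?_ (congrArg₂ (· + ·) e1 e2).symm
  ring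

/-! ### The integrability defect of an endomorphism -/

section Defect

variable (J : ∀ m : M, GTan E m →L[ℝ] GTan E m)

/-- The Courant–Nijenhuis concomitant `[Ju, Jv] - J([Ju, v] + [u, Jv])`. -/
def concomitant (u v : ∀ m : M, GTan E m) (x : M) : GTan E x :=
  courant (fun m ↦ J m (u m)) (fun m ↦ J m (v m)) x
    - J x (courant (fun m ↦ J m (u m)) v x + courant u (fun m ↦ J m (v m)) x)

omit [IsManifold 𝓘(ℝ, E) ∞ M] [FiniteDimensional ℝ E] in
theorem concomitant_swap (u v : ∀ m : M, GTan E m) (x : M) :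
    concomitant J u v x = -concomitant J v u x := by
  unfold concomitant
  rw [courant_swap (fun m ↦ J m (u m)), courant_swap (fun m ↦ J m (u m)) v, courant_swap u,
    ← neg_add, map_neg, add_comm]
  abel

theorem concomitant_add_left {u u' v : ∀ m : M, GTan E m} {x : M} (hu : GDiffAt u x)
    (hu' : GDiffAt u' x) (hv : GDiffAt v x) (hJu : GDiffAt (fun m ↦ J m (u m)) x)
    (hJu' : GDiffAt (fun m ↦ J m (u' m)) x) (hJv : GDiffAt (fun m ↦ J m (v m)) x) :
    concomitant J (fun m ↦ u m + u' m) v x = concomitant J u v x + concomitant J u' v x := by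
  unfold concomitant
  simp only [map_add]
  rw [courant_add_left hJu hJu' hJv, courant_add_left hJu hJu' hv, courant_add_left hu hu' hJv]
  simp only [map_add]
  abel

theorem concomitant_add_right {u v v' : ∀ m : M, GTan E m} {x : M} (hu : GDiffAt u x)
    (hv : GDiffAt v x) (hv' : GDiffAt v' x) (hJu : GDiffAt (fun m ↦ J m (u m)) x)
    (hJv : GDiffAt (fun m ↦ J m (v m)) x) (hJv' : GDiffAt (fun m ↦ J m (v' m)) x) :
    concomitant J u (fun m ↦ v m + v' m) x = concomitant J u v x + concomitant J u v' x := by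
  rw [concomitant_swap, concomitant_add_left J hv hv' hu hJv hJv' hJu, concomitant_swap J u v,
    concomitant_swap J u v', neg_add]

end Defect

/-! ### Exterior derivatives of 2-forms -/

theorem TwoForm.d_apply (σ : TwoForm E M) {X Y Z : ∀ m : M, Tan E m} {x : M} (hX : VDiffAt X x)
    (hY : VDiffAt Y x) (hZ : VDiffAt Z x) :
    σ.d x ![X x, Y x, Z x] =
      mvfderiv 𝓘(ℝ, E) (fun m ↦ σ.flat m (Y m) (Z m)) x (X x)
        - mvfderiv 𝓘(ℝ, E) (fun m ↦ σ.flat m (X m) (Z m)) x (Y x)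
        + mvfderiv 𝓘(ℝ, E) (fun m ↦ σ.flat m (X m) (Y m)) x (Z x)
        - σ.flat x (bracket X Y x) (Z x) + σ.flat x (bracket X Z x) (Y x)
        - σ.flat x (bracket Y Z x) (X x) :=
  extD_altOfBilin_apply σ.alternating (fun _ _ ↦ mdifferentiableAt_flat σ) hX hY hZ

theorem TwoForm.dTwist_apply {σ : TwoForm E M} {a : EndoField E M} (h : σ.Commutes a)
    {X Y Z : ∀ m : M, Tan E m} {x : M} (hX : VDiffAt X x) (hY : VDiffAt Y x)
    (hZ : VDiffAt Z x) :
    TwoForm.dTwist h x ![X x, Y x, Z x] =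
      mvfderiv 𝓘(ℝ, E) (fun m ↦ σ.flat m (a m (Y m)) (Z m)) x (X x)
        - mvfderiv 𝓘(ℝ, E) (fun m ↦ σ.flat m (a m (X m)) (Z m)) x (Y x)
        + mvfderiv 𝓘(ℝ, E) (fun m ↦ σ.flat m (a m (X m)) (Y m)) x (Z x)
        - σ.flat x (a x (bracket X Y x)) (Z x) + σ.flat x (a x (bracket X Z x)) (Y x)
        - σ.flat x (a x (bracket Y Z x)) (X x) :=
  extD_altOfBilin_apply (B := σ.twist a) h.twist_self
    (fun _ _ hX hY ↦ mdifferentiableAt_flat σ (vDiffAt_endo a hX) hY) hX hY hZ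

end GenGeom

end

noncomputable section

namespace GenGeom

variable {E : Type*} [NormedAddCommGroup E] [NormedSpace ℝ E]
  {M : Type*} [TopologicalSpace M] [ChartedSpace E M] [IsManifold 𝓘(ℝ, E) ∞ M]

/-! ### The concomitant of a block endomorphism -/

theorem TwoForm.flat_swap (σ : TwoForm E M) (x : M) (v w : Tan E x) :
    σ.flat x v w = -σ.flat x w v := by
  have h := σ.alternating x (v + w)
  simp only [map_add, add_apply, σ.alternating] at h
  linarith

theorem Bivector.sharp_swap (π : Bivector E M) (x : M) (α β : Cot E x) :
    β (π.sharp x α) = -α (π.sharp x β) := by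
  have h := π.alternating x (α + β)
  simp only [map_add, add_apply, π.alternating] at h
  linarith

theorem isAlmostSubtangent_blockEndo_iff (a : EndoField E M) (π : Bivector E M)
    (σ : TwoForm E M) :
    IsAlmostSubtangent (blockEndo a π σ) ↔
      (∀ x : M, (a x).comp (π.sharp x) = (π.sharp x).comp (dual a x)) ∧
      (∀ x : M, (a x).comp (a x) + (π.sharp x).comp (σ.flat x) = 0) ∧ σ.Commutes a := by
  constructor
  · intro h
    have hv : ∀ (x : M) (v : Tan E x), blockEndo a π σ x (blockEndo a π σ x (v, 0)) = 0 :=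
      fun x v ↦ DFunLike.congr_fun (h x) (v, 0)
    have hc : ∀ (x : M) (ξ : Cot E x), blockEndo a π σ x (blockEndo a π σ x (0, ξ)) = 0 :=
      fun x ξ ↦ DFunLike.congr_fun (h x) (0, ξ)
    simp only [blockEndo_apply, map_zero, add_zero, sub_zero, zero_add, zero_sub, map_neg,
      Prod.mk_eq_zero] at hv hc
    refine ⟨fun x ↦ ?_, fun x ↦ ?_, fun x ↦ ?_⟩
    · exact ContinuousLinearMap.ext fun ξ ↦ add_neg_eq_zero.1 (hc x ξ).1
    · exact ContinuousLinearMap.ext fun v ↦ (hv x v).1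
    · exact ContinuousLinearMap.ext fun v ↦ (sub_eq_zero.1 (hv x v).2).symm
  · rintro ⟨h1, h2, h3⟩ x
    refine ContinuousLinearMap.ext fun ⟨v, ξ⟩ ↦ ?_
    have e1 : ∀ ζ, a x (π.sharp x ζ) = π.sharp x (dual a x ζ) := fun ζ ↦ DFunLike.congr_fun (h1 x) ζ
    have e2 : ∀ w, a x (a x w) + π.sharp x (σ.flat x w) = 0 := fun w ↦ DFunLike.congr_fun (h2 x) w
    have e3 : ∀ w, dual a x (σ.flat x w) = σ.flat x (a x w) := fun w ↦ DFunLike.congr_fun (h3 x) w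
    change blockEndo a π σ x (blockEndo a π σ x (v, ξ)) = 0
    simp only [blockEndo_apply, Prod.mk_eq_zero, map_add, map_sub, e1, e3]
    refine ⟨?_, ?_⟩
    · rw [← e2 v]; abel
    · refine ContinuousLinearMap.ext fun w ↦ ?_
      -- The remaining entry `σ_♯ π^♯ + (a^*)²`, tested on `w`, is the transpose of `a² + π^♯ σ_♯`.
      have e4 := congrArg ξ (e2 w)
      rw [map_add, map_zero, π.sharp_swap x (σ.flat x w) ξ, σ.flat_swap] at e4
      simp only [add_apply, sub_apply, dual_apply, zero_apply]
      linarith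

section

variable (a : EndoField E M) (π : Bivector E M) (σ : TwoForm E M)

theorem blockEndo_vector (x : M) (v : Tan E x) :
    blockEndo a π σ x (v, 0) = (a x v, σ.flat x v) := by
  simp [blockEndo_apply]

theorem blockEndo_covector (x : M) (ξ : Cot E x) :
    blockEndo a π σ x (0, ξ) = (π.sharp x ξ, -dual a x ξ) := by
  simp [blockEndo_apply]

variable [FiniteDimensional ℝ E]

theorem piBracket_apply (ξ η : OneForm E M) {Z : ∀ m : M, Tan E m} {x : M} (hZ : VDiffAt Z x) :
    piBracket π ξ η x (Z x) =
      mvfderiv 𝓘(ℝ, E) (fun m ↦ η m (Z m)) x (π.sharp x (ξ x))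
        - η x (bracket (fun m ↦ π.sharp m (ξ m)) Z x)
        - mvfderiv 𝓘(ℝ, E) (fun m ↦ ξ m (Z m)) x (π.sharp x (η x))
        + ξ x (bracket (fun m ↦ π.sharp m (η m)) Z x)
        - mvfderiv 𝓘(ℝ, E) (fun m ↦ η m (π.sharp m (ξ m))) x (Z x) := by
  simp only [piBracket, sub_apply, lieD_apply (cDiffAt_section _ x) (vDiffAt_sharp π _ x) hZ,
    Bivector.pair]
  ring

/-- By skewness of `σ` the two half differentials add up to `d(σ(X, Y))`, the term completing
`L_X(σ_♯ Y) - L_Y(σ_♯ X)` to an expression in `dσ` and `[X, Y]`. -/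
theorem courant_vector_vector {X Y : ∀ m : M, Tan E m} {x : M} (hX : VDiffAt X x)
    (hY : VDiffAt Y x) :
    courant (fun m ↦ (a m (X m), σ.flat m (X m))) (fun m ↦ (Y m, 0)) x
        + courant (fun m ↦ (X m, 0)) (fun m ↦ (a m (Y m), σ.flat m (Y m))) x =
      (bracket (fun m ↦ a m (X m)) Y x + bracket X (fun m ↦ a m (Y m)) x,
        σ.flat x (bracket X Y x) + int2 (X x) (Y x) (σ.d x)) := by
  refine Prod.ext rfl (cot_ext fun Z hZ ↦ ?_)
  rw [Prod.snd_add, add_apply, courant_snd_apply (vDiffAt_endo a hX) (cDiffAt_flat σ hX) hY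
    (cDiffAt_zero x) hZ, courant_snd_apply hX (cDiffAt_zero x) (vDiffAt_endo a hY)
    (cDiffAt_flat σ hY) hZ]
  simp only [add_apply, int2_apply, σ.d_apply hX hY hZ, zero_apply, mvfderiv_zero_fun]
  rw [mvfderiv_neg_apply (fun m ↦ σ.flat_swap m (Y m) (X m)), σ.flat_swap x (bracket X Z x),
    σ.flat_swap x (bracket Y Z x)]
  ring

/-- The term `-π^♯ σ_♯ [X, Y]` supplies the `a² [X, Y]` of the Nijenhuis tensor. -/
theorem concomitant_vector_vector_fst
    (hsq : ∀ x : M, (a x).comp (a x) + (π.sharp x).comp (σ.flat x) = 0)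
    {X Y : ∀ m : M, Tan E m} {x : M} (hX : VDiffAt X x) (hY : VDiffAt Y x) :
    (concomitant (blockEndo a π σ) (fun m ↦ (X m, 0)) (fun m ↦ (Y m, 0)) x).1 =
      nijenhuis (fun m ↦ a m) X Y x - π.sharp x (int2 (X x) (Y x) (σ.d x)) := by
  have e : π.sharp x (σ.flat x (bracket X Y x)) = -a x (a x (bracket X Y x)) :=
    eq_neg_of_add_eq_zero_right (DFunLike.congr_fun (hsq x) (bracket X Y x))
  simp only [concomitant, blockEndo_vector]
  rw [courant_vector_vector a σ hX hY, blockEndo_apply]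
  simp only [Prod.fst_sub, courant, nijenhuis, map_add, e]
  abel

theorem concomitant_vector_vector_snd (h : σ.Commutes a) {X Y Z : ∀ m : M, Tan E m} {x : M}
    (hX : VDiffAt X x) (hY : VDiffAt Y x) (hZ : VDiffAt Z x) :
    (concomitant (blockEndo a π σ) (fun m ↦ (X m, 0)) (fun m ↦ (Y m, 0)) x).2 (Z x) =
      σ.d x ![a x (X x), Y x, Z x] + σ.d x ![X x, a x (Y x), Z x]
        + σ.d x ![X x, Y x, a x (Z x)] - TwoForm.dTwist h x ![X x, Y x, Z x] := by
  have hc : ∀ (m : M) (v w : Tan E m), σ.flat m v (a m w) = σ.flat m (a m v) w := fun m v w ↦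
    DFunLike.congr_fun (DFunLike.congr_fun (h m) v) w
  have haX := vDiffAt_endo a hX
  have haY := vDiffAt_endo a hY
  have haZ := vDiffAt_endo a hZ
  have d1 := σ.d_apply haX hY hZ
  have d2 := σ.d_apply hX haY hZ
  simp only [concomitant, blockEndo_vector]
  rw [courant_vector_vector a σ hX hY, blockEndo_apply]
  simp only [Prod.snd_sub, sub_apply, dual_apply, add_apply, map_add, int2_apply,
    courant_snd_apply haX (cDiffAt_flat σ hX) haY (cDiffAt_flat σ hY) hZ,
    TwoForm.dTwist_apply h hX hY hZ]
  rw [d1, d2]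
  -- All occurrences of `a` move to the first slot of `σ`, so both sides involve only `σ_a` and `σ`
  -- with matching arguments.
  simp only [hc]
  rw [mvfderiv_neg_apply (f := fun m ↦ σ.flat m (a m (Y m)) (X m))
    (g := fun m ↦ σ.flat m (a m (X m)) (Y m)) (fun m ↦ by rw [σ.flat_swap, hc]),
    σ.flat_swap x (Y x), σ.flat_swap x (X x)]
  ring

/-- The half differentials are `∓½ d(η(aX))` and cancel; `σ` drops out because it is paired with the
zero field. -/
theorem courant_vector_covector (X : ∀ m : M, Tan E m) (η : OneForm E M) {x : M}
    (hX : VDiffAt X x) :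
    courant (fun m ↦ (a m (X m), σ.flat m (X m))) (fun m ↦ (0, η m)) x
        + courant (fun m ↦ (X m, 0)) (fun m ↦ (π.sharp m (η m), -dual a m (η m))) x =
      (bracket X (fun m ↦ π.sharp m (η m)) x,
        lieD (fun m ↦ a m (X m)) (fun m ↦ η m) x - lieD X (fun m ↦ dual a m (η m)) x) := by
  have hη := cDiffAt_section η x
  have haη := cDiffAt_dual a hη
  refine Prod.ext ((congrArg (· + _) (bracket_zero_right _ x)).trans (zero_add _))
    (cot_ext fun Z hZ ↦ ?_)
  rw [Prod.snd_add, add_apply, courant_snd_apply (vDiffAt_endo a hX) (cDiffAt_flat σ hX)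
    (vDiffAt_zero x) hη hZ, courant_snd_apply hX (cDiffAt_zero x) (vDiffAt_sharp π η x) haη.neg hZ]
  simp only [sub_apply, lieD_apply hη (vDiffAt_endo a hX) hZ, lieD_apply haη hX hZ,
    zero_apply, mvfderiv_zero_fun, map_zero, bracket_zero_left, neg_apply, dual_apply]
  rw [mvfderiv_neg_apply (g := fun m ↦ η m (a m (Z m))) (fun m ↦ rfl),
    mvfderiv_neg_apply (g := fun m ↦ η m (a m (X m))) (fun m ↦ rfl)]
  ring

/-- Pairing with `ξ` lets skewness move `π^♯` onto `ξ`; what remains is the (S2) defect contracted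
with `X`. -/
theorem concomitant_vector_covector_fst
    (hcomm : ∀ x : M, (a x).comp (π.sharp x) = (π.sharp x).comp (dual a x))
    (ξ η : OneForm E M) {X : ∀ m : M, Tan E m} {x : M} (hX : VDiffAt X x) :
    ξ x (concomitant (blockEndo a π σ) (fun m ↦ (X m, 0)) (fun m ↦ (0, η m)) x).1 =
      (lieD (fun y ↦ π.sharp y (ξ y)) (fun y ↦ dual a y (η y)) x
        - lieD (fun y ↦ π.sharp y (η y)) (fun y ↦ dual a y (ξ y)) x
        - mvfderiv 𝓘(ℝ, E) (fun y ↦ π.pair y (dual a y (ξ y)) (η y)) x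
        - dual a x (piBracket π ξ η x)) (X x) := by
  have hξ := cDiffAt_section ξ x
  have hη := cDiffAt_section η x
  have hP := vDiffAt_sharp π ξ x
  have hQ := vDiffAt_sharp π η x
  have haX := vDiffAt_endo a hX
  have hpair : (fun y ↦ π.pair y (dual a y (ξ y)) (η y)) =
      fun y ↦ η y (a y (π.sharp y (ξ y))) :=
    funext fun y ↦ congrArg (η y) (DFunLike.congr_fun (hcomm y) (ξ y)).symm
  simp only [concomitant, blockEndo_vector, blockEndo_covector]
  rw [courant_vector_covector a π σ X η hX, blockEndo_apply, hpair]
  simp only [Prod.fst_sub, courant, map_sub, map_add, sub_apply, dual_apply]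
  rw [π.sharp_swap x _ (ξ x), π.sharp_swap x _ (ξ x), piBracket_apply π ξ η haX,
    lieD_apply hη haX hP, lieD_apply (cDiffAt_dual a hη) hX hP,
    lieD_apply (cDiffAt_dual a hη) hP hX, lieD_apply (cDiffAt_dual a hξ) hQ hX]
  simp only [dual_apply]
  rw [bracket_swap _ X, bracket_swap _ X, bracket_swap _ (fun m ↦ a m (X m)),
    bracket_swap _ (fun m ↦ a m (X m))]
  simp only [map_neg]
  ring

/-- This shows that the second mixed component is controlled by (S3): by skewness, `η(π^♯ i_{X∧Y}
dσ)` is `-dσ(X, Y, π^♯η)`, which Cartan's formula expands. -/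
theorem concomitant_vector_covector_snd
    (hsq : ∀ x : M, (a x).comp (a x) + (π.sharp x).comp (σ.flat x) = 0)
    (η : OneForm E M) {X Y : ∀ m : M, Tan E m} {x : M} (hX : VDiffAt X x) (hY : VDiffAt Y x) :
    (concomitant (blockEndo a π σ) (fun m ↦ (X m, 0)) (fun m ↦ (0, η m)) x).2 (Y x) =
      η x (π.sharp x (int2 (X x) (Y x) (σ.d x)) - nijenhuis (fun m ↦ a m) X Y x) := by
  have hη := cDiffAt_section η x
  have haη := cDiffAt_dual a hη
  have hQ := vDiffAt_sharp π η x
  have haX := vDiffAt_endo a hX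
  have haY := vDiffAt_endo a hY
  have hd := σ.d_apply hX hY hQ
  -- Trades `η ∘ a²` for `σ` paired with `π^♯η`, the only shape occurring in the expansion of `dσ`.
  have hsqη : ∀ (m : M) (v : Tan E m), η m (a m (a m v)) = σ.flat m v (π.sharp m (η m)) := by
    intro m v
    have h := congrArg (η m) (DFunLike.congr_fun (hsq m) v)
    simp only [add_apply, ContinuousLinearMap.comp_apply, map_add, zero_apply, map_zero,
      π.sharp_swap m _ (η m)] at h
    linarith
  simp only [concomitant, blockEndo_vector, blockEndo_covector]
  rw [courant_vector_covector a π σ X η hX, blockEndo_apply]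
  simp only [Prod.snd_sub, sub_apply, dual_apply, map_sub,
    courant_snd_apply haX (cDiffAt_flat σ hX) hQ haη.neg hY, lieD_apply hη haX haY,
    lieD_apply haη hX haY, nijenhuis, map_add, neg_apply]
  rw [π.sharp_swap x _ (η x), int2_apply, hd]
  simp only [hsqη]
  rw [mvfderiv_neg_apply (g := fun m ↦ η m (a m (Y m))) (fun m ↦ rfl),
    mvfderiv_neg_apply (f := fun m ↦ -σ.flat m (X m) (π.sharp m (η m))) (fun m ↦ rfl),
    bracket_swap (fun m ↦ π.sharp m (η m)) Y, σ.flat_swap x _ (X x), σ.flat_swap x _ (Y x)]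
  simp only [map_neg]
  ring

/-- The two halves of `-d(π(ξ, η))` come one from each bracket, by skewness of `π`; the `a^*` parts
meet only zero fields. -/
theorem courant_covector_covector (ξ η : OneForm E M) (x : M) :
    courant (fun m ↦ (π.sharp m (ξ m), -dual a m (ξ m))) (fun m ↦ (0, η m)) x
        + courant (fun m ↦ (0, ξ m)) (fun m ↦ (π.sharp m (η m), -dual a m (η m))) x =
      (0, piBracket π ξ η x) := by
  have hξ := cDiffAt_section ξ x
  have hη := cDiffAt_section η x
  refine Prod.ext ((congrArg₂ (· + ·) (bracket_zero_right _ x) (bracket_zero_left _ x)).trans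
    (zero_add _)) (cot_ext fun Z hZ ↦ ?_)
  rw [Prod.snd_add, add_apply, courant_snd_apply (vDiffAt_sharp π ξ x) (cDiffAt_dual a hξ).neg
    (vDiffAt_zero x) hη hZ, courant_snd_apply (vDiffAt_zero x) hξ (vDiffAt_sharp π η x)
    (cDiffAt_dual a hη).neg hZ, piBracket_apply π ξ η hZ]
  simp only [mvfderiv_zero_fun, map_zero, bracket_zero_left, zero_apply]
  rw [mvfderiv_neg_apply (f := fun m ↦ ξ m (π.sharp m (η m)))
    (fun m ↦ π.sharp_swap m (η m) (ξ m))]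
  ring

theorem concomitant_covector_covector_fst (ξ η : OneForm E M) (x : M) :
    (concomitant (blockEndo a π σ) (fun m ↦ (0, ξ m)) (fun m ↦ (0, η m)) x).1 =
      bracket (fun y ↦ π.sharp y (ξ y)) (fun y ↦ π.sharp y (η y)) x
        - π.sharp x (piBracket π ξ η x) := by
  simp only [concomitant, blockEndo_covector]
  rw [courant_covector_covector, blockEndo_covector]
  rfl

theorem concomitant_covector_covector_snd
    (hcomm : ∀ x : M, (a x).comp (π.sharp x) = (π.sharp x).comp (dual a x))
    (ξ η : OneForm E M) (x : M) :
    (concomitant (blockEndo a π σ) (fun m ↦ (0, ξ m)) (fun m ↦ (0, η m)) x).2 =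
      dual a x (piBracket π ξ η x)
        - (lieD (fun y ↦ π.sharp y (ξ y)) (fun y ↦ dual a y (η y)) x
          - lieD (fun y ↦ π.sharp y (η y)) (fun y ↦ dual a y (ξ y)) x
          - mvfderiv 𝓘(ℝ, E) (fun y ↦ π.pair y (dual a y (ξ y)) (η y)) x) := by
  have hξ := cDiffAt_dual a (cDiffAt_section ξ x)
  have hη := cDiffAt_dual a (cDiffAt_section η x)
  have hP := vDiffAt_sharp π ξ x
  have hQ := vDiffAt_sharp π η x
  -- Commutation and skewness identify both pairings in the Courant bracket with `±π(a^*ξ, η)`, so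
  -- the half differentials combine into a whole one.
  have hpair : ∀ y, π.pair y (dual a y (ξ y)) (η y) = dual a y (η y) (π.sharp y (ξ y)) :=
    fun y ↦ congrArg (η y) (DFunLike.congr_fun (hcomm y) (ξ y)).symm
  have hpair' : ∀ y, dual a y (ξ y) (π.sharp y (η y)) = -π.pair y (dual a y (ξ y)) (η y) :=
    fun y ↦ π.sharp_swap y (η y) (dual a y (ξ y))
  refine cot_ext fun Z hZ ↦ ?_
  simp only [concomitant, blockEndo_covector]
  rw [courant_covector_covector, blockEndo_covector]
  simp only [Prod.snd_sub, sub_apply, courant_snd_apply hP hξ.neg hQ hη.neg hZ,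
    lieD_apply hη hP hZ, lieD_apply hξ hQ hZ, neg_apply, hpair', ← hpair, neg_neg]
  rw [mvfderiv_neg_apply (g := fun m ↦ dual a m (η m) (Z m)) (fun m ↦ rfl),
    mvfderiv_neg_apply (g := fun m ↦ dual a m (ξ m) (Z m)) (fun m ↦ rfl),
    mvfderiv_neg_apply (g := fun y ↦ π.pair y (dual a y (ξ y)) (η y)) (fun m ↦ rfl)]
  ring

end

end GenGeom

end

/-! ### Testing on global sections and assembling the equivalence -/

noncomputable section

namespace GenGeom

variable {E : Type*} [NormedAddCommGroup E] [NormedSpace ℝ E] [FiniteDimensional ℝ E]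
  {M : Type*} [TopologicalSpace M] [ChartedSpace E M] [IsManifold 𝓘(ℝ, E) ∞ M]

theorem eq_zero_of_forall_section_eq_zero [T2Space M] {x : M} {α : Cot E x}
    (h : ∀ Z : VectorField E M, α (Z x) = 0) : α = 0 := by
  refine ContinuousLinearMap.ext fun v ↦ ?_
  obtain ⟨Z, rfl⟩ := exists_section (E := E) (F := E) x v
  exact h Z

theorem eq_zero_of_forall_oneForm_eq_zero [T2Space M] {x : M} {v : Tan E x}
    (h : ∀ ξ : OneForm E M, ξ x v = 0) : v = 0 := by
  refine SeparatingDual.eq_zero_of_forall_dual_eq_zero (V := E) (R := ℝ) fun f ↦ ?_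
  obtain ⟨ξ, hξ⟩ := exists_section (E := E) (F := E →L[ℝ] ℝ) (V := fun m : M ↦ Tan E m →L[ℝ] ℝ) x f
  have := h ξ
  rw [hξ] at this
  exact this

/-- The concomitant of a block endomorphism splits into its values on vector fields and 1-forms. -/
theorem concomitant_sec (a : EndoField E M) (π : Bivector E M) (σ : TwoForm E M)
    (X Y : VectorField E M) (ξ η : OneForm E M) (x : M) :
    concomitant (blockEndo a π σ) (sec X ξ) (sec Y η) x =
      concomitant (blockEndo a π σ) (fun m ↦ (X m, 0)) (fun m ↦ (Y m, 0)) x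
        + concomitant (blockEndo a π σ) (fun m ↦ (X m, 0)) (fun m ↦ (0, η m)) x
        - concomitant (blockEndo a π σ) (fun m ↦ (Y m, 0)) (fun m ↦ (0, ξ m)) x
        + concomitant (blockEndo a π σ) (fun m ↦ (0, ξ m)) (fun m ↦ (0, η m)) x := by
  have hv (X : VectorField E M) : GDiffAt (fun m ↦ ((X m, 0) : GTan E m)) x :=
    ⟨vDiffAt_section X x, cDiffAt_zero x⟩
  have hc (ξ : OneForm E M) : GDiffAt (fun m ↦ ((0, ξ m) : GTan E m)) x :=
    ⟨vDiffAt_zero x, cDiffAt_section ξ x⟩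
  have hJv (X : VectorField E M) : GDiffAt (fun m ↦ blockEndo a π σ m (X m, 0)) x := by
    simp only [blockEndo_vector]
    exact ⟨vDiffAt_endo a (vDiffAt_section X x), cDiffAt_flat σ (vDiffAt_section X x)⟩
  have hJc (ξ : OneForm E M) : GDiffAt (fun m ↦ blockEndo a π σ m (0, ξ m)) x := by
    simp only [blockEndo_covector]
    exact ⟨vDiffAt_sharp π ξ x, (cDiffAt_dual a (cDiffAt_section ξ x)).neg⟩
  have hJ (X : VectorField E M) (ξ : OneForm E M) :
      GDiffAt (fun m ↦ blockEndo a π σ m ((X m, 0) + (0, ξ m))) x := by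
    simp only [map_add]
    exact (hJv X).add (hJc ξ)
  have hs (X : VectorField E M) (ξ : OneForm E M) :
      sec X ξ = fun m ↦ ((X m, 0) : GTan E m) + (0, ξ m) := by
    funext m
    simp [sec]
  rw [hs, hs, concomitant_add_left _ (hv X) (hc ξ) ((hv Y).add (hc η)) (hJv X) (hJc ξ) (hJ Y η),
    concomitant_add_right _ (hv X) (hv Y) (hc η) (hJv X) (hJv Y) (hJc η),
    concomitant_add_right _ (hc ξ) (hv Y) (hc η) (hJc ξ) (hJv Y) (hJc η),
    concomitant_swap _ (fun m ↦ (0, ξ m)) (fun m ↦ (Y m, 0))]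
  abel

/-- A block endomorphism is integrable iff its concomitant vanishes on vector fields, on 1-forms,
and on mixed pairs. -/
theorem isIntegrable_blockEndo_iff (a : EndoField E M) (π : Bivector E M) (σ : TwoForm E M) :
    IsIntegrable (blockEndo a π σ) ↔
      (∀ (X Y : VectorField E M) (x : M),
        concomitant (blockEndo a π σ) (fun m ↦ (X m, 0)) (fun m ↦ (Y m, 0)) x = 0) ∧
      (∀ (X : VectorField E M) (η : OneForm E M) (x : M),
        concomitant (blockEndo a π σ) (fun m ↦ (X m, 0)) (fun m ↦ (0, η m)) x = 0) ∧
      ∀ (ξ η : OneForm E M) (x : M),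
        concomitant (blockEndo a π σ) (fun m ↦ (0, ξ m)) (fun m ↦ (0, η m)) x = 0 := by
  constructor
  -- Zero sections isolate the three types of pairs.
  · exact fun h ↦ ⟨fun X Y x ↦ h X Y 0 0 x, fun X η x ↦ h X 0 0 η x, fun ξ η x ↦ h 0 0 ξ η x⟩
  · rintro ⟨h1, h2, h3⟩ X Y ξ η x
    refine (concomitant_sec a π σ X Y ξ η x).trans ?_
    rw [h1, h2, h2, h3]
    simp

end GenGeom

end

theorem proposition1
    {E : Type*} [NormedAddCommGroup E] [NormedSpace ℝ E] [FiniteDimensional ℝ E]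
    {M : Type*} [TopologicalSpace M] [T2Space M] [ChartedSpace E M] [IsManifold 𝓘(ℝ, E) ∞ M]
    (a : GenGeom.EndoField E M) (π : GenGeom.Bivector E M) (σ : GenGeom.TwoForm E M) :
    GenGeom.IsSubtangent (GenGeom.blockEndo a π σ) ↔
      -- (S1)
      (∀ (ξ η : GenGeom.OneForm E M) (x : M),
        π.sharp x (GenGeom.piBracket π ξ η x) =
          GenGeom.bracket (fun y ↦ π.sharp y (ξ y)) (fun y ↦ π.sharp y (η y)) x) ∧
      -- (S2)
      ((∀ x : M, (a x).comp (π.sharp x) = (π.sharp x).comp (GenGeom.dual a x)) ∧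
        ∀ (ξ η : GenGeom.OneForm E M) (x : M),
          GenGeom.dual a x (GenGeom.piBracket π ξ η x) =
            GenGeom.lieD (fun y ↦ π.sharp y (ξ y)) (fun y ↦ GenGeom.dual a y (η y)) x
              - GenGeom.lieD (fun y ↦ π.sharp y (η y)) (fun y ↦ GenGeom.dual a y (ξ y)) x
              - mvfderiv 𝓘(ℝ, E) (fun y ↦ π.pair y (GenGeom.dual a y (ξ y)) (η y)) x) ∧
      -- (S3)
      ((∀ x : M, (a x).comp (a x) + (π.sharp x).comp (σ.flat x) = 0) ∧
        ∀ (X Y : GenGeom.VectorField E M) (x : M),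
          GenGeom.nijenhuis (fun y ↦ a y) (fun y ↦ X y) (fun y ↦ Y y) x =
            π.sharp x (GenGeom.int2 (X x) (Y x) (σ.d x))) ∧
      -- (S4)
      (∃ h : σ.Commutes a, ∀ (X Y Z : GenGeom.VectorField E M) (x : M),
        GenGeom.TwoForm.dTwist h x ![X x, Y x, Z x] =
          σ.d x ![a x (X x), Y x, Z x] + σ.d x ![X x, a x (Y x), Z x]
            + σ.d x ![X x, Y x, a x (Z x)]) := by
  open GenGeom in
  rw [IsSubtangent, isAlmostSubtangent_blockEndo_iff, isIntegrable_blockEndo_iff]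
  constructor
  -- The mixed identities are discarded: the pure pairs already yield every condition.
  · rintro ⟨⟨hcomm, hsq, hc⟩, hvv, -, hcc⟩
    refine ⟨fun ξ η x ↦ ?_, ⟨hcomm, fun ξ η x ↦ ?_⟩, ⟨hsq, fun X Y x ↦ ?_⟩, hc, fun X Y Z x ↦ ?_⟩
    · have h := congrArg Prod.fst (hcc ξ η x)
      rw [concomitant_covector_covector_fst] at h
      exact (sub_eq_zero.1 h).symm
    · have h := congrArg Prod.snd (hcc ξ η x)
      rw [concomitant_covector_covector_snd a π σ hcomm] at h
      exact sub_eq_zero.1 h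
    · have h := congrArg Prod.fst (hvv X Y x)
      rw [concomitant_vector_vector_fst a π σ hsq (vDiffAt_section X x) (vDiffAt_section Y x)] at h
      exact sub_eq_zero.1 h
    · have h := concomitant_vector_vector_snd a π σ hc (vDiffAt_section X x)
        (vDiffAt_section Y x) (vDiffAt_section Z x)
      rw [hvv] at h
      exact (sub_eq_zero.1 h.symm).symm
  · rintro ⟨h1, ⟨hcomm, h2⟩, ⟨hsq, h3⟩, hc, h4⟩
    refine ⟨⟨hcomm, hsq, hc⟩, fun X Y x ↦ Prod.ext ?_ ?_, fun X η x ↦ Prod.ext ?_ ?_,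
      fun ξ η x ↦ Prod.ext ?_ ?_⟩
    · rw [concomitant_vector_vector_fst a π σ hsq (vDiffAt_section X x) (vDiffAt_section Y x)]
      exact sub_eq_zero.2 (h3 X Y x)
    · refine eq_zero_of_forall_section_eq_zero fun Z ↦ ?_
      rw [concomitant_vector_vector_snd a π σ hc (vDiffAt_section X x) (vDiffAt_section Y x)
        (vDiffAt_section Z x)]
      exact sub_eq_zero.2 (h4 X Y Z x).symm
    -- The mixed components vanish by (S2) here and by (S3) in the next case.
    · refine eq_zero_of_forall_oneForm_eq_zero fun ξ ↦ ?_
      rw [concomitant_vector_covector_fst a π σ hcomm ξ η (vDiffAt_section X x), ← h2, sub_self]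
      rfl
    · refine eq_zero_of_forall_section_eq_zero fun Y ↦ ?_
      rw [concomitant_vector_covector_snd a π σ hsq η (vDiffAt_section X x)
        (vDiffAt_section Y x), ← h3, sub_self, map_zero]
    · rw [concomitant_covector_covector_fst]
      exact sub_eq_zero.2 (h1 ξ η x).symm
    · rw [concomitant_covector_covector_snd a π σ hcomm]
      exact sub_eq_zero.2 (h2 ξ η x)
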